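/- For a matrix $M$, let $\beta(M)$ be the smallest size of a set $R$ of columns such that any two different rows of $M$ differ in some column of $R$ (and $\beta(M)=+\infty$ if $M$ has two identical rows). For a graph $G$ with adjacency matrix $A$ and distance matrix $D$ (with $D(u,v)=+\infty$ for vertices in different components), let $\beta(G):=\beta(D)$ be the metric dimension of $G$, and let $A^*:=A+\mathrm{diag}(2)$ be obtained from $A$ by adding $2$ to each diagonal entry. Let $p=p_n\in[0,1]$ and $q=q_n=\min\{p,1-p\}$, let $G_{n,p}$ be the random graph on $n$ vertices in which each pair of distinct vertices is adjacent with probability $p$, independently of all other pairs, and let $A^*_{n,p}$ be the matrix $A^*$ of $G_{n,p}$. (a) If $$\frac{\ln^2(n)}{n^{1-C/2}}=o(q)\qquad(n\to\infty)\tag{1}$$ for some constant $1<C<2$, then $\beta(G_{n,p})=\beta(A^*_{n,p})$ with probability tending to $1$ as $n\to\infty$. (b) If (1) holds for every constant $1<C<2$, then $\beta(G_{n,p})=\beta(A^*_{n,p})\sim\frac{-2\ln(n)}{\ln(p^2+(1-p)^2)}$ with high probability; that is, for every $\varepsilon>0$, with probability tending to $1$ as $n\to\infty$, the two metric dimensions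 are equal and finite and $$\left|\frac{\beta(G_{n,p})}{-2\ln(n)/\ln(p^2+(1-p)^2)}-1\right|\le\varepsilon .$$ -/

import Mathlib

open Filter Topology Asymptotics

/-- A set `R` of columns resolves the matrix `M` if any two different rows of `M` differ in some
column belonging to `R`. -/
def Matrix.Resolves {m n α : Type*} (M : Matrix m n α) (R : Finset n) : Prop :=
  ∀ u v : m, u ≠ v → ∃ r ∈ R, M u r ≠ M v r

/-- The metric dimension `β(M)` of a matrix: the least size of a resolving set of columns,
and `⊤` if there is none. -/
noncomputable def Matrix.metricDimension {m n α : Type*} (M : Matrix m n α) : ℕ∞ :=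
  ⨅ (R : Finset n) (_ : M.Resolves R), (R.card : ℕ∞)

/-- The distance matrix `D` of a graph; vertices in different components are at distance `⊤`. -/
noncomputable def SimpleGraph.distanceMatrix {V : Type*} (G : SimpleGraph V) : Matrix V V ℕ∞ :=
  Matrix.of fun u v => G.edist u v

/-- The metric dimension `β(G)` of a graph: the least size of a set `R` of vertices such that
any two different vertices have different distances to some vertex of `R`. -/
noncomputable def SimpleGraph.metricDimension {V : Type*} (G : SimpleGraph V) : ℕ∞ :=
  G.distanceMatrix.metricDimension

open Classical in
/-- The modified adjacency matrix `A* = A + diag(2)` of a graph. -/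
noncomputable def SimpleGraph.adjMatrixStar {V : Type*} (G : SimpleGraph V) : Matrix V V ℕ :=
  G.adjMatrix ℕ + Matrix.diagonal (fun _ => 2)

/-- The condition `ln²(n) / n^(1 - C/2) = o(q)` with `q = min {p, 1 - p}`, for edge
probabilities `p = p n` that may depend on `n`. -/
def EdgeProbabilityCondition (p : ℕ → unitInterval) (C : ℝ) : Prop :=
  (fun n : ℕ => Real.log n ^ 2 / (n : ℝ) ^ (1 - C / 2)) =o[atTop]
    (fun n : ℕ => min (p n : ℝ) (1 - (p n : ℝ)))

/-- The quantity `-2 ln(n) / ln(p² + (1 - p)²)`. -/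
noncomputable def metricDimensionRate (n : ℕ) (p : ℝ) : ℝ :=
  -2 * Real.log n / Real.log (p ^ 2 + (1 - p) ^ 2)

/-!
Under the condition on `p` with some `C > 1`, `n p²` is much larger than `ln n`, so with high
probability any two vertices have a common neighbour. All distances are then at most `2`, and the
distance matrix is `2 - A*`; hence the two metric dimensions coincide
(`SimpleGraph.metricDimension_eq_of_commonNeighbors_nonempty`,
`SimpleGraph.binomialRandom_real_exists_commonNeighbors_eq_empty_le`). It remains to estimate
`β(A*)`. Let `s = p² + (1 - p)²` be the probability that two independent edge indicators agree, and
`k = -2 ln n / ln s`.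

*Upper bound.* The diagonal entries `2` separate the rows of `R` from all others. Two rows outside
`R` agree on `R` with probability `s ^ |R|`, so if `|R| ≥ (1 + ε / 2) k` then a union bound over
pairs shows that `R` resolves `A*` (`SimpleGraph.binomialRandom_real_not_resolves_le`).

*Lower bound.* Let `|R| = r ≤ (1 - ε) k`. Restricted to `R`, the rows outside `R` are independent
samples of a distribution `μ` on `{0, 1} ^ r` with `‖μ‖₂ = s ^ (r / 2) ≥ n ^ (ε - 1)`, and they have
to be distinct if `R` resolves `A*`. Splitting `2h` of them, `h = ⌊n / 4⌋`, into halves, the second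
half avoids the first one with probability at most `exp (-(h τ)² / (1 + h τ))`, `τ = ‖μ‖₂`
(`sum_injective_prod_le`). This is at most `exp (-n ^ ε / 16)`. There are at most `exp (k ln n)`
sets of size `r`, and if the condition holds for every `C < 2`, then `1 / q`, and with it `k`, is at
most `n ^ δ` for every `δ > 0` and large `n`; so the union bound over these sets succeeds
(`SimpleGraph.exists_lt_metricDimension_adjMatrixStar`).

All probabilities are bounded by finite sums, through the joint law of the indicators of finitely
many distinct edges (`SimpleGraph.binomialRandom_real_edges_le`).
-/

open MeasureTheory ProbabilityTheory unitInterval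

/-! ### The metric dimension of a matrix -/

namespace Matrix

variable {m n α : Type*} {M : Matrix m n α}

lemma Resolves.mono {R S : Finset n} (h : M.Resolves R) (hRS : R ⊆ S) : M.Resolves S :=
  fun u v huv => (h u v huv).imp fun _ hr => ⟨hRS hr.1, hr.2⟩

lemma Resolves.metricDimension_le {R : Finset n} (h : M.Resolves R) :
    M.metricDimension ≤ R.card :=
  iInf₂_le R h

lemma natCast_lt_metricDimension [Fintype n] {k : ℕ} (hk : k ≤ Fintype.card n)
    (h : ∀ R : Finset n, R.card = k → ¬ M.Resolves R) : (k : ℕ∞) < M.metricDimension := by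
  have hle : ((k + 1 : ℕ) : ℕ∞) ≤ M.metricDimension := by
    refine le_iInf₂ fun R hR => ?_
    rw [Nat.cast_le]
    by_contra hlt
    obtain ⟨S, hRS, hS⟩ := Finset.exists_superset_card_eq (s := R) (n := k) (by omega) hk
    exact h S hS (hR.mono hRS)
  exact lt_of_lt_of_le (by exact_mod_cast Nat.lt_succ_self k) hle

/-- The metric dimension depends only on which pairs of entries in a column coincide. -/
lemma metricDimension_congr {β : Type*} {N : Matrix m n β}
    (h : ∀ u v r, M u r = M v r ↔ N u r = N v r) : M.metricDimension = N.metricDimension := by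
  have : M.Resolves = N.Resolves := by
    funext R
    simp only [Resolves, ne_eq, h]
  simp only [metricDimension, this]

end Matrix

namespace SimpleGraph

variable {V : Type*} {G : SimpleGraph V}

lemma adjMatrixStar_self (u : V) : G.adjMatrixStar u u = 2 := by
  simp [adjMatrixStar]

open Classical in
lemma adjMatrixStar_of_ne {u v : V} (h : u ≠ v) :
    G.adjMatrixStar u v = if G.Adj u v then 1 else 0 := by
  simp [adjMatrixStar, h]

lemma adjMatrixStar_of_ne_eq_iff {u v r : V} (hu : u ≠ r) (hv : v ≠ r) :
    G.adjMatrixStar u r = G.adjMatrixStar v r ↔ (G.Adj u r ↔ G.Adj v r) := by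
  rw [adjMatrixStar_of_ne hu, adjMatrixStar_of_ne hv]
  split_ifs <;> simp_all

/-- The diagonal entries of `A*` differ from all others, so a column separates its own row from
every other row. -/
lemma adjMatrixStar_self_ne {u v : V} (h : u ≠ v) : G.adjMatrixStar u u ≠ G.adjMatrixStar v u := by
  rw [adjMatrixStar_self, adjMatrixStar_of_ne h.symm]
  split_ifs <;> simp

/-- Only pairs of vertices outside `R` have to be checked when `R` is to resolve `A*`. -/
lemma resolves_adjMatrixStar_of_forall_notMem {R : Finset V}
    (h : ∀ u v, u ≠ v → u ∉ R → v ∉ R → ∃ r ∈ R, ¬ (G.Adj u r ↔ G.Adj v r)) :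
    G.adjMatrixStar.Resolves R := by
  intro u v huv
  by_cases hu : u ∈ R
  · exact ⟨u, hu, adjMatrixStar_self_ne huv⟩
  by_cases hv : v ∈ R
  · exact ⟨v, hv, (adjMatrixStar_self_ne huv.symm).symm⟩
  obtain ⟨r, hr, hne⟩ := h u v huv hu hv
  refine ⟨r, hr, fun heq => hne ?_⟩
  exact (adjMatrixStar_of_ne_eq_iff (ne_of_mem_of_not_mem hr hu).symm
    (ne_of_mem_of_not_mem hr hv).symm).1 heq

/-- In diameter at most two the distance matrix is `2 - A*`. -/
lemma edist_eq_two_sub_adjMatrixStar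
    (h : ∀ u v : V, u ≠ v → (G.commonNeighbors u v).Nonempty) (u v : V) :
    G.edist u v = ((2 - G.adjMatrixStar u v : ℕ) : ℕ∞) := by
  by_cases huv : u = v
  · subst huv
    simp [adjMatrixStar_self]
  rw [adjMatrixStar_of_ne huv]
  split_ifs with hadj
  · simpa using edist_eq_one_iff_adj.2 hadj
  · simpa using edist_eq_two_iff.2 ⟨huv, hadj, h u v huv⟩

lemma metricDimension_eq_of_commonNeighbors_nonempty
    (h : ∀ u v : V, u ≠ v → (G.commonNeighbors u v).Nonempty) :
    G.metricDimension = G.adjMatrixStar.metricDimension := by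
  refine Matrix.metricDimension_congr fun u v r => ?_
  have hle : ∀ a b : V, G.adjMatrixStar a b ≤ 2 := by
    intro a b
    by_cases hab : a = b
    · subst hab
      rw [adjMatrixStar_self]
    · rw [adjMatrixStar_of_ne hab]
      split_ifs <;> simp
  have hu := hle u r
  have hv := hle v r
  simp only [distanceMatrix, Matrix.of_apply, edist_eq_two_sub_adjMatrixStar h, Nat.cast_inj]
  omega

end SimpleGraph

/-! ### Joint law of the edge indicators -/

/-- The probability that an edge indicator of `G(n, p)` takes the value `a`. -/
def edgeWeight (p : I) (a : Bool) : ℝ := if a then p else 1 - p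

lemma edgeWeight_nonneg (p : I) (a : Bool) : 0 ≤ edgeWeight p a := by
  unfold edgeWeight
  split_ifs
  · exact p.2.1
  · exact sub_nonneg.2 p.2.2

lemma sum_edgeWeight (p : I) : ∑ a, edgeWeight p a = 1 := by
  simp [edgeWeight]

lemma sum_edgeWeight_sq (p : I) : ∑ a, edgeWeight p a ^ 2 = (p : ℝ) ^ 2 + (1 - p) ^ 2 := by
  simp [edgeWeight]

namespace SimpleGraph

variable {V ι : Type*} [Countable V] [Fintype ι]

lemma binomialRandom_real_edges_eq_le (p : I) {f : ι → Sym2 V} (hf : f.Injective)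
    (hd : ∀ i, ¬ (f i).IsDiag) (y : ι → Bool) :
    (binomialRandom V p).real {G | ∀ i, y i = true ↔ f i ∈ G.edgeSet} ≤
      ∏ i, edgeWeight p (y i) := by
  classical
  have hfac (i : ι) :
      (toNNReal p • Measure.dirac (¬ (f i).IsDiag) + toNNReal (σ p) • Measure.dirac False :
        Measure Prop) {P | ∀ j, f j = f i → (y j = true ↔ P)} =
        ENNReal.ofReal (edgeWeight p (y i)) := by
    have hset : {P : Prop | ∀ j, f j = f i → (y j = true ↔ P)} = {P | y i = true ↔ P} := by
      ext P
      exact ⟨fun h => h i rfl, fun h j hj => hf hj ▸ h⟩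
    rw [hset]
    cases hy : y i
    · simp [hd i, edgeWeight, ← ENNReal.ofReal_coe_nnreal]
    · simp [hd i, edgeWeight, ← ENNReal.ofReal_coe_nnreal]
  rw [measureReal_def]
  refine ENNReal.toReal_le_of_le_ofReal
    (Finset.prod_nonneg fun i _ => edgeWeight_nonneg p (y i)) ?_
  rw [binomialRandom_apply, ENNReal.ofReal_prod_of_nonneg fun i _ => edgeWeight_nonneg p (y i)]
  calc _ ≤ Measure.infinitePi
        (fun e : Sym2 V ↦ toNNReal p • Measure.dirac (¬ e.IsDiag) +
          toNNReal (σ p) • Measure.dirac False)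
        (((Finset.univ.image f : Finset (Sym2 V)) : Set (Sym2 V)).pi
          fun e => {P | ∀ j, f j = e → (y j = true ↔ P)}) := by
        refine measure_mono ?_
        rintro _ ⟨G, hG, rfl⟩ e he j rfl
        exact hG j
    _ = _ := by
        rw [Measure.infinitePi_pi _ fun _ _ => MeasurableSpace.measurableSet_top,
          Finset.prod_image hf.injOn]
        exact Finset.prod_congr rfl fun i _ => hfac i

/-- The indicators of distinct edges are independent, so the probability of an event in them is at
most the sum of the product weights of the outcomes in it. -/
lemma binomialRandom_real_edges_le [DecidableEq ι] (p : I) {f : ι → Sym2 V} (hf : f.Injective)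
    (hd : ∀ i, ¬ (f i).IsDiag) {S : Set (SimpleGraph V)} {E : (ι → Bool) → Prop}
    [DecidablePred E]
    (hSE : ∀ G ∈ S, ∀ x : ι → Bool, (∀ i, x i = true ↔ f i ∈ G.edgeSet) → E x) :
    (binomialRandom V p).real S ≤ ∑ x, if E x then ∏ i, edgeWeight p (x i) else 0 := by
  classical
  rw [← Finset.sum_filter]
  have hcover : S ⊆ ⋃ x ∈ Finset.univ.filter E, {G | ∀ i, x i = true ↔ f i ∈ G.edgeSet} := by
    intro G hG
    have hx (i : ι) : decide (f i ∈ G.edgeSet) = true ↔ f i ∈ G.edgeSet := decide_eq_true_iff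
    exact Set.mem_biUnion (Finset.mem_filter.2 ⟨Finset.mem_univ _, hSE G hG _ hx⟩) hx
  exact (measureReal_mono hcover (measure_ne_top _ _)).trans <|
    (measureReal_biUnion_finset_le _ _).trans <|
      Finset.sum_le_sum fun x _ => binomialRandom_real_edges_eq_le p hf hd x

end SimpleGraph

open Real

/-! ### Collisions in a sample from a finite distribution -/

/-- The Laplace transform of `μ a`, for `a` drawn from `μ`. As no atom exceeds `τ = ‖μ‖₂`, the
bound `exp (-x) ≤ 1 / (1 + x) = 1 - x / (1 + x)` may be weakened to one linear in `x = t μ a`,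
whose mean is `t τ²`. -/
lemma sum_mul_exp_neg_le {α : Type*} [Fintype α] {μ : α → ℝ} (h0 : ∀ a, 0 ≤ μ a)
    (h1 : ∑ a, μ a = 1) {τ t : ℝ} (hτ : 0 ≤ τ) (hτ2 : ∑ a, μ a ^ 2 = τ ^ 2) (ht : 0 ≤ t) :
    ∑ a, μ a * exp (-(t * μ a)) ≤ exp (-(t * τ ^ 2 / (1 + t * τ))) := by
  have hle (a : α) : μ a ≤ τ := by
    refine le_of_sq_le_sq ?_ hτ
    rw [← hτ2]
    exact Finset.single_le_sum (f := fun a => μ a ^ 2) (fun _ _ => sq_nonneg _) (Finset.mem_univ a)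
  have key (a : α) : μ a * exp (-(t * μ a)) ≤ μ a - t * μ a ^ 2 / (1 + t * τ) := by
    have hta : 0 ≤ t * μ a := mul_nonneg ht (h0 a)
    have htτ : 0 ≤ t * τ := mul_nonneg ht hτ
    have hexp : exp (-(t * μ a)) ≤ 1 - t * μ a / (1 + t * τ) := by
      calc exp (-(t * μ a)) ≤ (1 + t * μ a)⁻¹ := by
            rw [exp_neg]
            exact inv_anti₀ (by positivity) (by linarith [add_one_le_exp (t * μ a)])
        _ = 1 - t * μ a / (1 + t * μ a) := by field_simp; ring
        _ ≤ _ := by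
            have := hle a
            gcongr
    calc _ ≤ μ a * (1 - t * μ a / (1 + t * τ)) := mul_le_mul_of_nonneg_left hexp (h0 a)
      _ = _ := by ring
  calc _ ≤ ∑ a, (μ a - t * μ a ^ 2 / (1 + t * τ)) := Finset.sum_le_sum fun a _ => key a
    _ = 1 - t * τ ^ 2 / (1 + t * τ) := by
        rw [Finset.sum_sub_distrib, h1, ← Finset.sum_div, ← Finset.mul_sum, hτ2]
    _ ≤ _ := by linarith [add_one_le_exp (-(t * τ ^ 2 / (1 + t * τ)))]

/-- A sample of size `2h` from `μ` is collision-free with probability at most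
`exp (-(h τ)² / (1 + h τ))`, where `τ = ‖μ‖₂`. If the first half is `x₁, …, x_h`, all distinct, the
second half avoids it with probability `(1 - ∑ μ(xᵢ)) ^ h ≤ ∏ exp (-h μ(xᵢ))`; dropping the
distinctness, the mean of this product is the `h`-th power of a Laplace transform. -/
lemma sum_injective_prod_le {α : Type*} [Fintype α] {h : ℕ}
    [DecidablePred (Function.Injective : (Fin h ⊕ Fin h → α) → Prop)] {μ : α → ℝ}
    (h0 : ∀ a, 0 ≤ μ a)
    (h1 : ∑ a, μ a = 1) {τ : ℝ} (hτ : 0 ≤ τ) (hτ2 : ∑ a, μ a ^ 2 = τ ^ 2) :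
    (∑ x : Fin h ⊕ Fin h → α, if x.Injective then ∏ i, μ (x i) else 0) ≤
      exp (-((h * τ) ^ 2 / (1 + h * τ))) := by
  classical
  -- the second half, for a given first half
  have inner (x : Fin h → α) (hx : x.Injective) :
      (∑ y : Fin h → α, if ∀ j i, y j ≠ x i then ∏ j, μ (y j) else 0) ≤
        ∏ i, exp (-(h * μ (x i))) := by
    have hsum : (∑ y : Fin h → α, if ∀ j i, y j ≠ x i then ∏ j, μ (y j) else 0) =
        (∑ a ∈ Finset.univ.filter fun a => ∀ i, a ≠ x i, μ a) ^ h := by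
      rw [Finset.sum_pow', ← Finset.sum_filter]
      refine Finset.sum_congr ?_ fun _ _ => rfl
      ext y
      simp [Fintype.mem_piFinset]
    have hsplit : (∑ a ∈ Finset.univ.filter fun a => ∀ i, a ≠ x i, μ a) = 1 - ∑ i, μ (x i) := by
      have himg : (∑ a ∈ Finset.univ.filter fun a => ¬ ∀ i, a ≠ x i, μ a) = ∑ i, μ (x i) := by
        rw [← Finset.sum_image (f := μ) (g := x) (s := Finset.univ) hx.injOn]
        refine Finset.sum_congr ?_ fun _ _ => rfl
        ext a
        simp [eq_comm]
      rw [← himg, ← h1, ← Finset.sum_filter_add_sum_filter_not Finset.univ fun a => ∀ i, a ≠ x i]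
      ring
    rw [hsum, ← exp_sum, Finset.sum_neg_distrib, ← Finset.mul_sum, neg_mul_eq_mul_neg, exp_nat_mul]
    refine pow_le_pow_left₀ (Finset.sum_nonneg fun a _ => h0 a) ?_ _
    rw [hsplit]
    linarith [add_one_le_exp (-∑ i, μ (x i))]
  calc _ ≤ ∑ z : (Fin h → α) × (Fin h → α), if z.1.Injective then (∏ i, μ (z.1 i)) *
          (if ∀ j i, z.2 j ≠ z.1 i then ∏ j, μ (z.2 j) else 0) else 0 := by
        rw [← (Equiv.sumArrowEquivProdArrow (Fin h) (Fin h) α).sum_comp]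
        refine Finset.sum_le_sum fun x _ => ?_
        by_cases hx : x.Injective
        · have hx1 : (fun i => x (Sum.inl i)).Injective := hx.comp Sum.inl_injective
          have hx2 : ∀ j i, x (Sum.inr j) ≠ x (Sum.inl i) := fun j i heq => by simpa using hx heq
          simp [hx, Equiv.sumArrowEquivProdArrow, Function.comp_def, hx1, hx2]
        · rw [if_neg hx]
          refine ite_nonneg (mul_nonneg (Finset.prod_nonneg fun _ _ => h0 _) ?_) le_rfl
          exact ite_nonneg (Finset.prod_nonneg fun _ _ => h0 _) le_rfl
    _ = ∑ x : Fin h → α, if x.Injective then (∏ i, μ (x i)) *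
          ∑ y : Fin h → α, (if ∀ j i, y j ≠ x i then ∏ j, μ (y j) else 0) else 0 := by
        rw [Fintype.sum_prod_type]
        refine Finset.sum_congr rfl fun x _ => ?_
        split_ifs <;> simp [Finset.mul_sum]
    _ ≤ ∑ x : Fin h → α, ∏ i, (μ (x i) * exp (-(h * μ (x i)))) := by
        refine Finset.sum_le_sum fun x _ => ?_
        rw [Finset.prod_mul_distrib]
        have hpos : 0 ≤ ∏ i, μ (x i) := Finset.prod_nonneg fun i _ => h0 (x i)
        split_ifs with hx
        · exact mul_le_mul_of_nonneg_left (inner x hx) hpos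
        · positivity
    _ = (∑ a, μ a * exp (-(h * μ a))) ^ h :=
        (Fintype.sum_pow (fun a => μ a * exp (-(h * μ a))) h).symm
    _ ≤ exp (-(h * τ ^ 2 / (1 + h * τ))) ^ h := by
        refine pow_le_pow_left₀ (Finset.sum_nonneg fun a _ => mul_nonneg (h0 a) (exp_pos _).le) ?_ _
        exact sum_mul_exp_neg_le h0 h1 hτ hτ2 h.cast_nonneg
    _ = _ := by
        rw [← exp_nat_mul]
        congr 1
        ring

/-! ### Probabilities of the relevant events in `G(n, p)` -/

namespace SimpleGraph

variable {V : Type*} [Countable V]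

/-- The adjacencies of two vertices `u`, `v` to the vertices of a set `W` are independent, so a
constraint `Q` imposed at each vertex of `W` separately holds with probability a `|W|`-th power. -/
lemma binomialRandom_real_pair_le (p : I) {u v : V} (huv : u ≠ v) {W : Finset V} (hu : u ∉ W)
    (hv : v ∉ W) {S : Set (SimpleGraph V)} {Q : Bool → Bool → Prop}
    [DecidableRel Q]
    (hS : ∀ G ∈ S, ∀ w ∈ W, ∀ a b : Bool,
      (a = true ↔ G.Adj u w) → (b = true ↔ G.Adj v w) → Q a b) :
    (binomialRandom V p).real S ≤
      (∑ a, ∑ b, if Q a b then edgeWeight p a * edgeWeight p b else 0) ^ W.card := by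
  classical
  have hc (c : Bool) : cond c u v ∉ W := by cases c <;> assumption
  have hf : (fun i : W × Bool => s(cond i.2 u v, (i.1 : V))).Injective := by
    rintro ⟨w, c⟩ ⟨w', c'⟩ heq
    rcases Sym2.eq_iff.1 heq with ⟨h1, h2⟩ | ⟨h1, -⟩
    · refine Prod.ext (Subtype.ext h2) ?_
      cases c <;> cases c' <;> simp_all
    · exact absurd (h1 ▸ w'.2) (hc c)
  have hd (i : W × Bool) : ¬ (s(cond i.2 u v, (i.1 : V))).IsDiag := by
    rw [Sym2.mk_isDiag_iff]
    exact fun h => hc i.2 (h ▸ i.1.2)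
  refine (binomialRandom_real_edges_le p hf hd (S := S)
    (E := fun x => ∀ w : W, Q (x (w, true)) (x (w, false))) ?_).trans_eq ?_
  · intro G hG x hx w
    exact hS G hG w w.2 _ _ (hx (w, true)) (hx (w, false))
  refine (Fintype.sum_equiv (Equiv.curry W Bool Bool) _ (fun y => ∏ w, if Q (y w true) (y w false)
    then edgeWeight p (y w true) * edgeWeight p (y w false) else 0) fun x => ?_).trans ?_
  · simp only [Equiv.curry_apply, Function.curry_apply]
    rw [Finset.prod_ite_zero, Fintype.prod_prod_type]
    simp
  calc _ = ∏ _w : W, ∑ z : Bool → Bool, if Q (z true) (z false) then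
          edgeWeight p (z true) * edgeWeight p (z false) else 0 := by
        rw [Finset.prod_univ_sum, Fintype.piFinset_univ]
    _ = _ := by
        rw [Finset.prod_const, Finset.card_univ, Fintype.card_coe]
        congr 1
        rw [← Fintype.sum_prod_type', ← ((Equiv.boolArrowEquivProd Bool).trans
          (Equiv.prodComm _ _)).sum_comp]
        rfl

/-- Two vertices outside `R` have the same neighbours in `R` with probability
`(p² + (1 - p)²) ^ |R|`. -/
lemma binomialRandom_real_agree_le (p : I) {u v : V} (huv : u ≠ v) {R : Finset V} (hu : u ∉ R)
    (hv : v ∉ R) :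
    (binomialRandom V p).real {G | ∀ r ∈ R, G.Adj u r ↔ G.Adj v r} ≤
      ((p : ℝ) ^ 2 + (1 - p) ^ 2) ^ R.card := by
  refine (binomialRandom_real_pair_le p huv hu hv (Q := fun a b => a = b) ?_).trans_eq ?_
  · intro G hG r hr a b ha hb
    rw [Bool.eq_iff_iff, ha, hb]
    exact hG r hr
  · simp [edgeWeight, sq]

lemma binomialRandom_real_commonNeighbors_eq_empty_le [Fintype V] (p : I) {u v : V}
    (huv : u ≠ v) :
    (binomialRandom V p).real {G | G.commonNeighbors u v = ∅} ≤
      (1 - (p : ℝ) ^ 2) ^ (Fintype.card V - 2) := by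
  classical
  refine (binomialRandom_real_pair_le p huv (W := ({u, v} : Finset V)ᶜ) (by simp) (by simp)
    (Q := fun a b => ¬ (a = true ∧ b = true)) ?_).trans_eq ?_
  · intro G hG w _ a b ha hb hab
    have hw : w ∈ G.commonNeighbors u v := ⟨ha.1 hab.1, hb.1 hab.2⟩
    rw [hG] at hw
    exact hw
  · rw [Finset.card_compl, Finset.card_pair huv]
    congr 1
    simp [edgeWeight]
    ring

lemma binomialRandom_real_exists_commonNeighbors_eq_empty_le [Fintype V] (p : I) :
    (binomialRandom V p).real {G | ¬ ∀ u v, u ≠ v → (G.commonNeighbors u v).Nonempty} ≤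
      (Fintype.card V : ℝ) ^ 2 * (1 - (p : ℝ) ^ 2) ^ (Fintype.card V - 2) := by
  classical
  have hcover : {G : SimpleGraph V | ¬ ∀ u v, u ≠ v → (G.commonNeighbors u v).Nonempty} ⊆
      ⋃ e ∈ (Finset.univ : Finset V).offDiag, {G | G.commonNeighbors e.1 e.2 = ∅} := by
    intro G hG
    simp only [Set.mem_ofPred_eq, not_forall, Set.not_nonempty_iff_eq_empty] at hG
    obtain ⟨u, v, huv, h⟩ := hG
    exact Set.mem_biUnion (x := (u, v)) (by simpa using huv) h
  refine (measureReal_mono hcover (measure_ne_top _ _)).trans <|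
    (measureReal_biUnion_finset_le _ _).trans ?_
  have hp : 0 ≤ 1 - (p : ℝ) ^ 2 := sub_nonneg.2 (pow_le_one₀ p.2.1 p.2.2)
  refine (Finset.sum_le_card_nsmul _ _ _ fun e he =>
    binomialRandom_real_commonNeighbors_eq_empty_le p (Finset.mem_offDiag.1 he).2.2).trans ?_
  rw [nsmul_eq_mul]
  gcongr
  rw [Finset.offDiag_card, Finset.card_univ, sq]
  exact_mod_cast Nat.sub_le _ _

lemma binomialRandom_real_not_resolves_le [Fintype V] (p : I) (R : Finset V) :
    (binomialRandom V p).real {G | ¬ G.adjMatrixStar.Resolves R} ≤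
      (Fintype.card V : ℝ) ^ 2 * ((p : ℝ) ^ 2 + (1 - p) ^ 2) ^ R.card := by
  classical
  have hcover : {G : SimpleGraph V | ¬ G.adjMatrixStar.Resolves R} ⊆
      ⋃ e ∈ Rᶜ.offDiag, {G | ∀ r ∈ R, G.Adj e.1 r ↔ G.Adj e.2 r} := by
    intro G hG
    by_contra hnot
    refine hG (resolves_adjMatrixStar_of_forall_notMem fun u v huv hu hv => ?_)
    by_contra! hex
    exact hnot (Set.mem_biUnion (x := (u, v)) (by simp [hu, hv, huv])
      fun r hr => by simpa using hex r hr)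
  refine (measureReal_mono hcover (measure_ne_top _ _)).trans <|
    (measureReal_biUnion_finset_le _ _).trans ?_
  refine (Finset.sum_le_card_nsmul _ _ (((p : ℝ) ^ 2 + (1 - p) ^ 2) ^ R.card) fun e he => ?_).trans
    ?_
  · obtain ⟨h1, h2, h12⟩ := Finset.mem_offDiag.1 he
    exact binomialRandom_real_agree_le p h12 (Finset.mem_compl.1 h1) (Finset.mem_compl.1 h2)
  rw [nsmul_eq_mul]
  gcongr
  have hcard : (Rᶜ).offDiag.card ≤ Fintype.card V ^ 2 := by
    rw [Finset.offDiag_card, sq]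
    exact (Nat.sub_le _ _).trans (Nat.mul_le_mul (Finset.card_le_univ _) (Finset.card_le_univ _))
  exact_mod_cast hcard

/-- If `R` resolves `A*`, then the rows of `2h` vertices outside `R`, restricted to `R`, form a
collision-free sample of `2h` independent Bernoulli vectors. -/
lemma binomialRandom_real_resolves_le [Fintype V] (p : I) (R : Finset V) {h : ℕ}
    (hh : h + h + R.card ≤ Fintype.card V) {τ : ℝ} (hτ : 0 ≤ τ)
    (hτ2 : ((p : ℝ) ^ 2 + (1 - p) ^ 2) ^ R.card = τ ^ 2) :
    (binomialRandom V p).real {G | G.adjMatrixStar.Resolves R} ≤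
      exp (-((h * τ) ^ 2 / (1 + h * τ))) := by
  classical
  obtain ⟨g⟩ : Nonempty (Fin h ⊕ Fin h ↪ {u // u ∈ Rᶜ}) := by
    rw [Function.Embedding.nonempty_iff_card_le]
    simp only [Fintype.card_sum, Fintype.card_fin, Fintype.card_coe, Finset.card_compl]
    omega
  have hg (i : Fin h ⊕ Fin h) : (g i : V) ∉ R := Finset.mem_compl.1 (g i).2
  have hf : (fun i : (Fin h ⊕ Fin h) × R => s((g i.1 : V), (i.2 : V))).Injective := by
    rintro ⟨i, r⟩ ⟨i', r'⟩ heq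
    rcases Sym2.eq_iff.1 heq with ⟨h1, h2⟩ | ⟨h1, -⟩
    · exact Prod.ext (g.injective (Subtype.ext h1)) (Subtype.ext h2)
    · exact absurd (h1 ▸ r'.2) (hg i)
  have hd (i : (Fin h ⊕ Fin h) × R) : ¬ (s((g i.1 : V), (i.2 : V))).IsDiag := by
    rw [Sym2.mk_isDiag_iff]
    exact fun heq => hg i.1 (heq ▸ i.2.2)
  refine (binomialRandom_real_edges_le p hf hd
    (E := fun x => (fun i r => x (i, r) : Fin h ⊕ Fin h → R → Bool).Injective) ?_).trans ?_
  · intro G hG x hx i j hij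
    by_contra hne
    obtain ⟨r, hr, hdiff⟩ := hG (g i) (g j) fun heq => hne (g.injective (Subtype.ext heq))
    refine hdiff ((adjMatrixStar_of_ne_eq_iff (ne_of_mem_of_not_mem hr (hg i)).symm
      (ne_of_mem_of_not_mem hr (hg j)).symm).2 ?_)
    have hi := hx (i, ⟨r, hr⟩)
    have hj := hx (j, ⟨r, hr⟩)
    rw [mem_edgeSet] at hi hj
    rw [← hi, ← hj, show x (i, ⟨r, hr⟩) = x (j, ⟨r, hr⟩) from congrFun hij _]
  have h1 : ∑ y : R → Bool, ∏ r, edgeWeight p (y r) = 1 := by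
    rw [← Fintype.piFinset_univ, ← Finset.prod_univ_sum]
    simp only [sum_edgeWeight, Finset.prod_const_one]
  have h2 : ∑ y : R → Bool, (∏ r, edgeWeight p (y r)) ^ 2 = τ ^ 2 := by
    simp only [← Finset.prod_pow]
    rw [← Fintype.piFinset_univ, ← hτ2,
      ← Finset.prod_univ_sum (fun _ => Finset.univ) fun _ a => edgeWeight p a ^ 2]
    simp only [sum_edgeWeight_sq, Finset.prod_const, Finset.card_univ, Fintype.card_coe]
  refine (Fintype.sum_equiv (Equiv.curry (Fin h ⊕ Fin h) R Bool) _
    (fun y => if y.Injective then ∏ i, ∏ r, edgeWeight p (y i r) else 0) fun x => ?_).trans_le ?_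
  · rw [Fintype.prod_prod_type]
    rfl
  · exact sum_injective_prod_le (μ := fun y : R → Bool => ∏ r, edgeWeight p (y r))
      (fun y => Finset.prod_nonneg fun r _ => edgeWeight_nonneg p (y r)) h1 hτ h2

lemma binomialRandom_real_exists_resolves_le [Fintype V] (p : I) {r h : ℕ}
    (hh : h + h + r ≤ Fintype.card V) {τ : ℝ} (hτ : 0 ≤ τ)
    (hτ2 : ((p : ℝ) ^ 2 + (1 - p) ^ 2) ^ r = τ ^ 2) :
    (binomialRandom V p).real {G | ∃ R : Finset V, R.card = r ∧ G.adjMatrixStar.Resolves R} ≤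
      (Fintype.card V : ℝ) ^ r * exp (-((h * τ) ^ 2 / (1 + h * τ))) := by
  have hcover : {G : SimpleGraph V | ∃ R : Finset V, R.card = r ∧ G.adjMatrixStar.Resolves R} ⊆
      ⋃ R ∈ Finset.powersetCard r Finset.univ, {G | G.adjMatrixStar.Resolves R} := by
    rintro G ⟨R, hR, hres⟩
    exact Set.mem_biUnion (x := R) (by simpa using hR) hres
  refine (measureReal_mono hcover (measure_ne_top _ _)).trans <|
    (measureReal_biUnion_finset_le _ _).trans ?_
  refine (Finset.sum_le_card_nsmul _ _ (exp (-((h * τ) ^ 2 / (1 + h * τ)))) fun R hR => ?_).trans ?_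
  · have hR := (Finset.mem_powersetCard.1 hR).2
    subst hR
    exact binomialRandom_real_resolves_le p R hh hτ hτ2
  rw [nsmul_eq_mul, Finset.card_powersetCard, Finset.card_univ]
  gcongr
  exact_mod_cast Nat.choose_le_pow _ _

end SimpleGraph

/-! ### The rate `-2 ln(n) / ln(p² + (1 - p)²)` -/

lemma half_le_sq_add_sq (p : ℝ) : 1 / 2 ≤ p ^ 2 + (1 - p) ^ 2 := by
  nlinarith [sq_nonneg (2 * p - 1)]

lemma neg_log_sq_add_sq_le_one (p : ℝ) : -log (p ^ 2 + (1 - p) ^ 2) ≤ 1 := by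
  have h := log_le_log (by norm_num) (half_le_sq_add_sq p)
  have h2 : log (1 / 2 : ℝ) = -log 2 := by rw [one_div, log_inv]
  linarith [log_two_lt_d9]

/-- `-ln (p² + (1 - p)²) ≥ 2 p (1 - p) ≥ min {p, 1 - p}`. -/
lemma min_le_neg_log_sq_add_sq (p : I) :
    min (p : ℝ) (1 - p) ≤ -log ((p : ℝ) ^ 2 + (1 - p) ^ 2) := by
  have hp0 := p.2.1
  have hp1 := p.2.2
  have hlog := log_le_sub_one_of_pos
    (lt_of_lt_of_le (by norm_num) (half_le_sq_add_sq (p : ℝ)))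
  have hmin : min (p : ℝ) (1 - p) ≤ 2 * p * (1 - p) := by
    rcases le_total (p : ℝ) (1 / 2) with h | h
    · refine (min_le_left _ _).trans ?_
      nlinarith
    · refine (min_le_right _ _).trans ?_
      nlinarith
  nlinarith

lemma two_mul_log_le_metricDimensionRate {n : ℕ} {p : I} (hq : 0 < min (p : ℝ) (1 - p)) :
    2 * log n ≤ metricDimensionRate n p := by
  have hL := hq.trans_le (min_le_neg_log_sq_add_sq p)
  have hlog := log_natCast_nonneg n
  have heq : metricDimensionRate n p = 2 * log n / -log ((p : ℝ) ^ 2 + (1 - p) ^ 2) := by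
    rw [metricDimensionRate, div_neg, neg_mul, neg_div]
  rw [heq, le_div_iff₀ hL]
  nlinarith [neg_log_sq_add_sq_le_one (p : ℝ)]

lemma metricDimensionRate_mul_neg_log {n : ℕ} {p : I} (hq : 0 < min (p : ℝ) (1 - p)) :
    metricDimensionRate n p * -log ((p : ℝ) ^ 2 + (1 - p) ^ 2) = 2 * log n := by
  have hL := hq.trans_le (min_le_neg_log_sq_add_sq p)
  rw [metricDimensionRate, mul_neg, div_mul_cancel₀ _ (by linarith)]
  ring

/-- If `q = min {p, 1 - p}` is at least `ln² n / n ^ δ`, then the rate is at most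
`2 n ^ δ / ln n`. -/
lemma metricDimensionRate_mul_log_le {n : ℕ} {p : I} {δ : ℝ} (hn : 1 ≤ log n)
    (hq : log n ^ 2 / (n : ℝ) ^ δ ≤ min (p : ℝ) (1 - p)) :
    metricDimensionRate n p * log n ≤ 2 * (n : ℝ) ^ δ := by
  have hn0 : (0 : ℝ) < n := by
    rcases Nat.eq_zero_or_pos n with rfl | h
    · norm_num at hn
    · exact_mod_cast h
  have hN : 0 < (n : ℝ) ^ δ := rpow_pos_of_pos hn0 δ
  have hq0 : 0 < min (p : ℝ) (1 - p) := lt_of_lt_of_le (by positivity) hq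
  have hrate := metricDimensionRate_mul_neg_log (n := n) hq0
  have hk : 0 ≤ metricDimensionRate n p :=
    (by linarith : 0 ≤ 2 * log n).trans (two_mul_log_le_metricDimensionRate hq0)
  have h1 : metricDimensionRate n p * (log n ^ 2 / (n : ℝ) ^ δ) ≤ 2 * log n :=
    (mul_le_mul_of_nonneg_left (hq.trans (min_le_neg_log_sq_add_sq p)) hk).trans_eq hrate
  rw [← mul_div_assoc, div_le_iff₀ hN] at h1
  refine le_of_mul_le_mul_right ?_ (by linarith : 0 < log n)
  linarith

/-! ### Bounds for the metric dimension at fixed `n` -/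

namespace SimpleGraph

/-- A fixed set of about `(1 + ε / 2) k` columns, `k` being the rate, resolves `A*` with high
probability, by a union bound over the at most `n²` pairs of rows. -/
lemma exists_metricDimension_adjMatrixStar_le {n : ℕ} {p : I} {ε δ : ℝ} (hε : 0 < ε)
    (hε1 : ε ≤ 1) (hn : 1 ≤ log n) (hεn : 1 ≤ ε * log n) (hδ : 16 * (n : ℝ) ^ δ ≤ n)
    (hq : log n ^ 2 / (n : ℝ) ^ δ ≤ min (p : ℝ) (1 - p)) :
    ∃ r : ℕ, r ≤ (1 + ε) * metricDimensionRate n p ∧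
      (binomialRandom (Fin n) p).real
        {G | ¬ G.adjMatrixStar.metricDimension ≤ r} ≤ (n : ℝ) ^ (-ε) := by
  have hn0 : (0 : ℝ) < n := by
    rcases Nat.eq_zero_or_pos n with rfl | h
    · norm_num at hn
    · exact_mod_cast h
  have hN : 0 < (n : ℝ) ^ δ := rpow_pos_of_pos hn0 δ
  have hq0 : 0 < min (p : ℝ) (1 - p) := lt_of_lt_of_le (by positivity) hq
  set s : ℝ := (p : ℝ) ^ 2 + (1 - p) ^ 2 with hs
  set k := metricDimensionRate n p with hkdef
  have hs0 : 0 < s := lt_of_lt_of_le (by norm_num) (half_le_sq_add_sq (p : ℝ))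
  have hL : 0 < -log s := hq0.trans_le (min_le_neg_log_sq_add_sq p)
  have hkL : k * -log s = 2 * log n := metricDimensionRate_mul_neg_log hq0
  have hk : 2 * log n ≤ k := two_mul_log_le_metricDimensionRate hq0
  have hkn : k * log n ≤ 2 * (n : ℝ) ^ δ := metricDimensionRate_mul_log_le hn hq
  set r := ⌈(1 + ε / 2) * k⌉₊ with hr
  have hr1 : (1 + ε / 2) * k ≤ r := Nat.le_ceil _
  have hr2 : (r : ℝ) ≤ (1 + ε) * k := by
    have := Nat.ceil_lt_add_one (a := (1 + ε / 2) * k) (by nlinarith)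
    nlinarith
  have hrn : r ≤ n := by
    have : (r : ℝ) ≤ n := by nlinarith
    exact_mod_cast this
  obtain ⟨R, hR⟩ := Finset.exists_subset_card_eq (s := (Finset.univ : Finset (Fin n))) (n := r)
    (by simpa using hrn)
  refine ⟨r, hr2, ?_⟩
  have hsub : {G : SimpleGraph (Fin n) | ¬ G.adjMatrixStar.metricDimension ≤ r} ⊆
      {G | ¬ G.adjMatrixStar.Resolves R} := fun G hG hres =>
    hG (hR.2 ▸ hres.metricDimension_le)
  refine (measureReal_mono hsub (measure_ne_top _ _)).trans <|
    (binomialRandom_real_not_resolves_le p R).trans ?_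
  rw [hR.2, Fintype.card_fin, ← hs, ← rpow_natCast s r, rpow_def_of_pos hs0, rpow_def_of_pos hn0,
    ← exp_log hn0, ← exp_nat_mul, log_exp, ← exp_add]
  refine exp_le_exp.2 ?_
  push_cast
  nlinarith

/-- No set of `⌊(1 - ε) k⌋` columns, `k` being the rate, resolves `A*` with high probability: there
are at most `exp (k ln n) ≤ exp (2 n ^ δ)` such sets, and each of them resolves `A*` with
probability at most `exp (-n ^ ε / 16)`. -/
lemma exists_lt_metricDimension_adjMatrixStar {n : ℕ} {p : I} {ε δ : ℝ} (hε : 0 < ε)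
    (hε1 : ε ≤ 1) (hεδ : ε = δ + δ) (hn : 1 ≤ log n) (hδ : 16 * (n : ℝ) ^ δ ≤ n)
    (hδ2 : 48 ≤ (n : ℝ) ^ δ) (hq : log n ^ 2 / (n : ℝ) ^ δ ≤ min (p : ℝ) (1 - p)) :
    ∃ r : ℕ, (1 - ε) * metricDimensionRate n p < r + 1 ∧
      (binomialRandom (Fin n) p).real
        {G | ¬ (r : ℕ∞) < G.adjMatrixStar.metricDimension} ≤ exp (-(n : ℝ) ^ δ) := by
  have hn0 : (0 : ℝ) < n := by
    rcases Nat.eq_zero_or_pos n with rfl | h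
    · norm_num at hn
    · exact_mod_cast h
  have hN : 0 < (n : ℝ) ^ δ := rpow_pos_of_pos hn0 δ
  have hq0 : 0 < min (p : ℝ) (1 - p) := lt_of_lt_of_le (by positivity) hq
  set s : ℝ := (p : ℝ) ^ 2 + (1 - p) ^ 2 with hs
  set k := metricDimensionRate n p with hkdef
  have hs0 : 0 < s := lt_of_lt_of_le (by norm_num) (half_le_sq_add_sq (p : ℝ))
  have hL : 0 < -log s := hq0.trans_le (min_le_neg_log_sq_add_sq p)
  have hkL : k * -log s = 2 * log n := metricDimensionRate_mul_neg_log hq0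
  have hk : 2 * log n ≤ k := two_mul_log_le_metricDimensionRate hq0
  have hkn : k * log n ≤ 2 * (n : ℝ) ^ δ := metricDimensionRate_mul_log_le hn hq
  set r := ⌊(1 - ε) * k⌋₊ with hr
  have hr1 : (r : ℝ) ≤ (1 - ε) * k := Nat.floor_le (by nlinarith)
  have hrk : (r : ℝ) ≤ k := by nlinarith
  have hrn : 4 * r ≤ n := by
    have : 4 * (r : ℝ) ≤ n := by nlinarith
    exact_mod_cast this
  refine ⟨r, Nat.lt_floor_add_one _, ?_⟩
  have hsub : {G : SimpleGraph (Fin n) | ¬ (r : ℕ∞) < G.adjMatrixStar.metricDimension} ⊆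
      {G | ∃ R : Finset (Fin n), R.card = r ∧ G.adjMatrixStar.Resolves R} := by
    intro G hG
    by_contra hnot
    refine hG (Matrix.natCast_lt_metricDimension (by simp; omega)
      fun R hR hres => hnot ⟨R, hR, hres⟩)
  set h := n / 4 with hh
  set τ := exp (r * log s / 2) with hτ
  have hτ2 : s ^ r = τ ^ 2 := by
    rw [hτ, ← exp_nat_mul, ← rpow_natCast s r, rpow_def_of_pos hs0]
    congr 1
    push_cast
    ring
  refine (measureReal_mono hsub (measure_ne_top _ _)).trans <|
    (binomialRandom_real_exists_resolves_le p (r := r) (h := h) (by simp; omega) (exp_pos _).le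
      hτ2).trans ?_
  -- As `s ^ (r / 2) ≥ n ^ (ε - 1)`, the collision parameter `h τ` is at least `n ^ ε / 8`.
  have hhn : (n : ℝ) / 8 ≤ h := by
    have h8 : (8 : ℝ) ≤ n := by linarith
    have h8' : 8 ≤ n := by exact_mod_cast h8
    have : n ≤ 8 * h := by omega
    have : (n : ℝ) ≤ 8 * h := by exact_mod_cast this
    linarith
  have hτn : (n : ℝ) ^ δ * (n : ℝ) ^ δ ≤ n * τ := by
    rw [← rpow_add hn0, ← hεδ, rpow_def_of_pos hn0]
    nth_rewrite 2 [← exp_log hn0]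
    rw [hτ, ← exp_add]
    refine exp_le_exp.2 ?_
    nlinarith
  have hx : (n : ℝ) ^ δ * (n : ℝ) ^ δ / 8 ≤ h * τ := by
    have := mul_le_mul_of_nonneg_right hhn (exp_pos (r * log s / 2)).le
    rw [← hτ] at this
    linarith
  set N := (n : ℝ) ^ δ with hNdef
  have hx1 : 1 ≤ h * τ := by nlinarith
  have hx2 : h * τ / 2 ≤ (h * τ) ^ 2 / (1 + h * τ) := by
    rw [div_le_div_iff₀ (by norm_num) (by linarith)]
    nlinarith
  rw [Fintype.card_fin]
  nth_rewrite 1 [← exp_log hn0]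
  rw [← exp_nat_mul, ← exp_add]
  refine exp_le_exp.2 ?_
  have : r * log n ≤ 2 * N := (mul_le_mul_of_nonneg_right hrk (by linarith)).trans hkn
  nlinarith

/-- The bound `n² (1 - p²) ^ (n - 2)` for the existence of two vertices without a common neighbour
is small as soon as `n p²` exceeds a suitable multiple of `ln n`. -/
lemma binomialRandom_real_exists_commonNeighbors_eq_empty_le_inv {n : ℕ} {p : I} (hn : 4 ≤ n)
    (hp : 6 * log n ≤ n * (p : ℝ) ^ 2) :
    (binomialRandom (Fin n) p).real {G | ¬ ∀ u v, u ≠ v → (G.commonNeighbors u v).Nonempty} ≤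
      (n : ℝ)⁻¹ := by
  have hn0 : (0 : ℝ) < n := by exact_mod_cast (by omega : 0 < n)
  refine (binomialRandom_real_exists_commonNeighbors_eq_empty_le p).trans ?_
  have h1 : (0 : ℝ) ≤ 1 - (p : ℝ) ^ 2 := sub_nonneg.2 (pow_le_one₀ p.2.1 p.2.2)
  have h2 : (1 - (p : ℝ) ^ 2) ^ (n - 2) ≤ exp (-(3 * log n)) := by
    refine (pow_le_pow_left₀ h1 (one_sub_le_exp_neg _) _).trans ?_
    rw [← exp_nat_mul]
    refine exp_le_exp.2 ?_
    have h4 : (4 : ℝ) ≤ n := by exact_mod_cast hn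
    rw [Nat.cast_sub (by omega)]
    push_cast
    nlinarith [sq_nonneg (p : ℝ)]
  rw [Fintype.card_fin]
  calc (n : ℝ) ^ 2 * (1 - (p : ℝ) ^ 2) ^ (n - 2) ≤ n ^ 2 * exp (-(3 * log n)) := by gcongr
    _ = (n : ℝ)⁻¹ := by
      rw [exp_neg, ← log_rpow hn0, exp_log (by positivity)]
      norm_cast
      field_simp
      exact_mod_cast (pow_succ n 2).symm

end SimpleGraph

/-! ### Passage to the limit -/

namespace EdgeProbabilityCondition

variable {p : ℕ → I} {C : ℝ}

lemma eventually_le (h : EdgeProbabilityCondition p C) :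
    ∀ᶠ n : ℕ in atTop,
      log n ^ 2 / (n : ℝ) ^ (1 - C / 2) ≤ min (p n : ℝ) (1 - (p n : ℝ)) := by
  filter_upwards [h.bound one_pos] with n hn
  rw [one_mul, norm_eq_abs, norm_eq_abs,
    abs_of_nonneg (le_min (p n).2.1 (sub_nonneg.2 (p n).2.2))] at hn
  exact (le_abs_self _).trans hn

/-- Since `1 - C / 2 < 1 / 2`, the condition gives `p ≥ ln² n / √n`, so that
`n p² ≥ ln⁴ n`. -/
lemma eventually_log_le (h : EdgeProbabilityCondition p C) (hC : 1 < C) :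
    ∀ᶠ n : ℕ in atTop, 6 * log n ≤ n * (p n : ℝ) ^ 2 := by
  have hlog : Tendsto (fun n : ℕ => log n) atTop atTop :=
    tendsto_log_atTop.comp tendsto_natCast_atTop_atTop
  filter_upwards [h.eventually_le, hlog.eventually_ge_atTop 2, eventually_ge_atTop 1]
    with n hq hn hn1
  have hn1' : (1 : ℝ) ≤ n := by exact_mod_cast hn1
  have hn0 : (0 : ℝ) < n := by linarith
  have hp := hq.trans (min_le_left _ _)
  have hN : (n : ℝ) ^ (1 - C / 2) ≤ (n : ℝ) ^ (1 / 2 : ℝ) :=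
    rpow_le_rpow_of_exponent_le hn1' (by linarith)
  have hsq : ((n : ℝ) ^ (1 / 2 : ℝ)) ^ 2 = n := by
    rw [← sqrt_eq_rpow, sq_sqrt hn0.le]
  have hp2 : log n ^ 2 / (n : ℝ) ^ (1 / 2 : ℝ) ≤ p n :=
    (div_le_div_of_nonneg_left (sq_nonneg _) (rpow_pos_of_pos hn0 _) hN).trans hp
  have hp3 := pow_le_pow_left₀ (by positivity) hp2 2
  rw [div_pow, hsq, div_le_iff₀ hn0] at hp3
  refine le_trans ?_ (hp3.trans_eq (mul_comm _ _))
  have h8 : 2 ^ 3 ≤ log (n : ℝ) ^ 3 := pow_le_pow_left₀ (by norm_num) hn 3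
  nlinarith

lemma eventually_commonNeighbors (h : EdgeProbabilityCondition p C) (hC : 1 < C) :
    ∀ᶠ n : ℕ in atTop, (SimpleGraph.binomialRandom (Fin n) (p n)).real
      {G | ¬ ∀ u v, u ≠ v → (G.commonNeighbors u v).Nonempty} ≤ (n : ℝ)⁻¹ := by
  filter_upwards [h.eventually_log_le hC, eventually_ge_atTop 4] with n hp hn
  exact SimpleGraph.binomialRandom_real_exists_commonNeighbors_eq_empty_le_inv hn hp

end EdgeProbabilityCondition

lemma tendsto_measure_one_of_compl_le {Ω : ℕ → Type*} [∀ n, MeasurableSpace (Ω n)]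
    {P : ∀ n, Measure (Ω n)} [∀ n, IsProbabilityMeasure (P n)] {S : ∀ n, Set (Ω n)} {f : ℕ → ℝ}
    (hf : Tendsto f atTop (𝓝 0)) (h : ∀ᶠ n in atTop, (P n).real (S n)ᶜ ≤ f n) :
    Tendsto (fun n => P n (S n)) atTop (𝓝 1) := by
  have hlow : Tendsto (fun n => 1 - ENNReal.ofReal (f n)) atTop (𝓝 1) := by
    have := ENNReal.Tendsto.sub (tendsto_const_nhds (x := (1 : ENNReal)) (f := atTop))
      (ENNReal.tendsto_ofReal hf) (Or.inl ENNReal.one_ne_top)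
    simpa using this
  refine tendsto_of_tendsto_of_tendsto_of_le_of_le' hlow tendsto_const_nhds ?_
    (Eventually.of_forall fun n => prob_le_one)
  filter_upwards [h] with n hn
  rw [tsub_le_iff_right, ← measure_univ (μ := P n), ← Set.union_compl_self (S n)]
  refine (measure_union_le _ _).trans (add_le_add_right ?_ _)
  rw [← ofReal_measureReal]
  exact ENNReal.ofReal_le_ofReal hn

theorem tendsto_metricDimension_eq {p : ℕ → I} {C : ℝ} (hC : 1 < C)
    (h : EdgeProbabilityCondition p C) :
    Tendsto
      (fun n : ℕ => SimpleGraph.binomialRandom (Fin n) (p n)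
        {G | G.metricDimension = G.adjMatrixStar.metricDimension}) atTop (𝓝 1) := by
  refine tendsto_measure_one_of_compl_le tendsto_inv_atTop_nhds_zero_nat ?_
  filter_upwards [h.eventually_commonNeighbors hC] with n hn
  refine (measureReal_mono ?_ (measure_ne_top _ _)).trans hn
  exact fun G hG hcommon =>
    hG (SimpleGraph.metricDimension_eq_of_commonNeighbors_nonempty hcommon)

theorem tendsto_metricDimension_div_rate {p : ℕ → I}
    (h : ∀ C : ℝ, 1 < C → C < 2 → EdgeProbabilityCondition p C) {ε : ℝ} (hε : 0 < ε)
    (hε1 : ε ≤ 1 / 2) :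
    Tendsto
      (fun n : ℕ => SimpleGraph.binomialRandom (Fin n) (p n)
        {G | ∃ b : ℕ, G.metricDimension = (b : ℕ∞) ∧
          G.adjMatrixStar.metricDimension = (b : ℕ∞) ∧
          |(b : ℝ) / metricDimensionRate n (p n) - 1| ≤ ε}) atTop (𝓝 1) := by
  -- With `C = 2 - 2δ` the hypothesis reads `ln² n / n ^ δ = o(q)`.
  obtain ⟨δ, hδ⟩ : ∃ δ : ℝ, ε = δ + δ := ⟨ε / 2, by ring⟩
  have hC := h (2 - 2 * δ) (by linarith) (by linarith)
  have hexp : 1 - (2 - 2 * δ) / 2 = δ := by ring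
  have hcast : Tendsto (fun n : ℕ => (n : ℝ)) atTop atTop := tendsto_natCast_atTop_atTop
  have hlog : Tendsto (fun n : ℕ => log n) atTop atTop := tendsto_log_atTop.comp hcast
  have hpow : Tendsto (fun n : ℕ => (n : ℝ) ^ δ) atTop atTop :=
    (tendsto_rpow_atTop (by linarith)).comp hcast
  have hpow' : Tendsto (fun n : ℕ => (n : ℝ) ^ (1 - δ)) atTop atTop :=
    (tendsto_rpow_atTop (by linarith)).comp hcast
  have hlim : Tendsto (fun n : ℕ => (n : ℝ)⁻¹ + ((n : ℝ) ^ (-ε) + exp (-(n : ℝ) ^ δ)))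
      atTop (𝓝 0) := by
    have h2 : Tendsto (fun n : ℕ => (n : ℝ) ^ (-ε)) atTop (𝓝 0) :=
      (tendsto_rpow_neg_atTop hε).comp hcast
    have h3 : Tendsto (fun n : ℕ => exp (-(n : ℝ) ^ δ)) atTop (𝓝 0) :=
      tendsto_exp_neg_atTop_nhds_zero.comp hpow
    simpa using tendsto_inv_atTop_nhds_zero_nat.add (h2.add h3)
  refine tendsto_measure_one_of_compl_le hlim ?_
  filter_upwards [hC.eventually_commonNeighbors (by linarith), hC.eventually_le,
    hlog.eventually_ge_atTop 1, hlog.eventually_ge_atTop (1 / ε), hpow.eventually_ge_atTop 48,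
    hpow'.eventually_ge_atTop 16, eventually_gt_atTop 0] with n hcommon hq hn hεn hN hN' hn0
  rw [hexp] at hq
  have hn0' : (0 : ℝ) < n := by exact_mod_cast hn0
  have hεn' : 1 ≤ ε * log n := by
    rw [div_le_iff₀ hε] at hεn
    linarith
  have h16 : 16 * (n : ℝ) ^ δ ≤ n := by
    have hmul : (n : ℝ) ^ (1 - δ) * (n : ℝ) ^ δ = n := by
      rw [← rpow_add hn0', sub_add_cancel, rpow_one]
    nlinarith
  obtain ⟨r₁, hr₁, hP₁⟩ := SimpleGraph.exists_metricDimension_adjMatrixStar_le hε (by linarith)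
    hn hεn' h16 hq
  obtain ⟨r₂, hr₂, hP₂⟩ := SimpleGraph.exists_lt_metricDimension_adjMatrixStar hε (by linarith)
    hδ hn h16 hN hq
  have hk : 0 < metricDimensionRate n (p n) :=
    (by linarith : 0 < 2 * log n).trans_le
      (two_mul_log_le_metricDimensionRate (lt_of_lt_of_le (by positivity) hq))
  refine (measureReal_mono (s₂ := {G | ¬ ∀ u v, u ≠ v → (G.commonNeighbors u v).Nonempty} ∪
    ({G | ¬ G.adjMatrixStar.metricDimension ≤ (r₁ : ℕ∞)} ∪
      {G | ¬ (r₂ : ℕ∞) < G.adjMatrixStar.metricDimension})) ?_ (measure_ne_top _ _)).trans <|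
    (measureReal_union_le _ _).trans <| add_le_add hcommon <|
      (measureReal_union_le _ _).trans <| add_le_add hP₁ hP₂
  intro G hG
  by_contra hnot
  simp only [Set.mem_union, Set.mem_ofPred_eq, not_or, not_not] at hnot
  obtain ⟨hnbr, hle, hlt⟩ := hnot
  obtain ⟨b, hb⟩ := ENat.ne_top_iff_exists.1 (ne_top_of_le_ne_top (ENat.natCast_ne_top r₁) hle)
  rw [← hb, Nat.cast_le] at hle
  rw [← hb, Nat.cast_lt] at hlt
  refine hG ⟨b, ?_, hb.symm, ?_⟩
  · rw [SimpleGraph.metricDimension_eq_of_commonNeighbors_nonempty hnbr, hb]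
  have hle' : (b : ℝ) ≤ r₁ := by exact_mod_cast hle
  have hlt' : (r₂ : ℝ) + 1 ≤ b := by exact_mod_cast hlt
  rw [abs_le]
  constructor
  · rw [neg_le_sub_iff_le_add, ← sub_le_iff_le_add, le_div_iff₀ hk]
    linarith
  · rw [sub_le_iff_le_add, div_le_iff₀ hk]
    linarith

theorem mainTheorem1 (p : ℕ → unitInterval) :
    ((∃ C : ℝ, 1 < C ∧ C < 2 ∧ EdgeProbabilityCondition p C) →
      Tendsto
        (fun n : ℕ => SimpleGraph.binomialRandom (Fin n) (p n)
          {G | G.metricDimension = G.adjMatrixStar.metricDimension})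
        atTop (𝓝 1)) ∧
    ((∀ C : ℝ, 1 < C → C < 2 → EdgeProbabilityCondition p C) →
      ∀ ε : ℝ, 0 < ε →
        Tendsto
          (fun n : ℕ => SimpleGraph.binomialRandom (Fin n) (p n)
            {G | ∃ b : ℕ, G.metricDimension = (b : ℕ∞) ∧
              G.adjMatrixStar.metricDimension = (b : ℕ∞) ∧
              |(b : ℝ) / metricDimensionRate n (p n) - 1| ≤ ε})
          atTop (𝓝 1)) := by
  refine ⟨fun ⟨C, hC, _, h⟩ => tendsto_metricDimension_eq hC h, fun h ε hε => ?_⟩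
  -- The event grows with `ε`, so it is enough to treat `ε ≤ 1 / 2`.
  refine tendsto_of_tendsto_of_tendsto_of_le_of_le
    (tendsto_metricDimension_div_rate h (lt_min hε (by norm_num)) (min_le_right ε (1 / 2)))
    tendsto_const_nhds (fun n => measure_mono ?_) fun n => prob_le_one
  rintro G ⟨b, h1, h2, h3⟩
  exact ⟨b, h1, h2, h3.trans (min_le_left _ _)⟩
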